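/- Let $G$ be a weighted digraph on a finite non-empty node set $N$, without self-loops. Write $w_{ij}>0$ for the weight of the branch from $j$ to $i$, and $w_{ij}=0$ if there is no such branch. Let $N_i^+=\{j: w_{ij}>0\}$ and $N_i^-=\{j: w_{ji}>0\}$ be the in- and out-neighborhoods of $i$. Suppose that $G$ is strongly connected, i.e. there is a directed path from every node to every other node. Consider the following systems, $i\in N$, on the positive orthant: (a) the entropic protocol $\dot x_i=-\sum_{j\in N_i^+}w_{ij}\,x_i\ln\frac{x_i}{x_j}$; (b) the scaling-invariant protocol $\dot x_i=\sum_{j\in N_i^+}w_{ij}(\ln x_j-\ln x_i)$; (c) the polynomial protocol $\dot x_i=-\prod_{j\in N_i^-}x_i^{w_{ji}}+\prod_{j\in N_i^+}x_j^{w_{ij}}$, under the additional assumption that the weighting is balanced, i.e. $\sum_j w_{ij}=\sum_j w_{ji}$ for all $i$. In each case, for every initial state $x(0)$ with all $x_i(0)>0$, a solution exists for all $t\ge 0$, and every solution on $[0,\infty)$ with this initial state stays positive and converges exponentially fast to a consensus state: there are $\bar x\in\mathbb{R}$, $C\in\mathbb{R}$ and $\lambda>0$ (which may depend on the trajectory)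 such that $|x_i(t)-\bar x|\le C e^{-\lambda t}$ for all $t\ge 0$ and $i\in N$. The state $\bar x\mathbf 1$ (all components equal to $\bar x$) is an equilibrium, and $\min_i x_i(0)\le\bar x\le\max_i x_i(0)$. Both inequalities are strict unless all the $x_i(0)$ are equal. -/

import Mathlib

/-- A weighted digraph on the node set `V`, given by its weighted adjacency matrix.
There is a branch from `j` to `i` exactly when `w i j` is positive, and `w i j` is then the
weight of that branch; there are no self-loops. -/
structure WeightedDigraph (V : Type*) where
  w : V → V → ℝ
  nonneg : ∀ i j, 0 ≤ w i j
  loopless : ∀ i, w i i = 0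

namespace WeightedDigraph

variable {V : Type*}

/-- The underlying digraph: `Adj j i` means that there is a branch from `j` to `i`. -/
def toDigraph (G : WeightedDigraph V) : Digraph V where
  Adj j i := 0 < G.w i j

/-- There is a directed path from every node to every other node. -/
def StronglyConnected (G : WeightedDigraph V) : Prop :=
  ∀ i j, Relation.ReflTransGen G.toDigraph.Adj i j

variable [Fintype V]

/-- At every node the total incoming weight equals the total outgoing weight. -/
def Balanced (G : WeightedDigraph V) : Prop :=
  ∀ i, ∑ j, G.w i j = ∑ j, G.w j i

open scoped Classical in
/-- The in-neighbourhood of `i`: the nodes `j` with a branch from `j` to `i`. -/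
noncomputable def inNbrs (G : WeightedDigraph V) (i : V) : Finset V :=
  Finset.univ.filter fun j => G.toDigraph.Adj j i

open scoped Classical in
/-- The out-neighbourhood of `i`: the nodes `j` with a branch from `i` to `j`. -/
noncomputable def outNbrs (G : WeightedDigraph V) (i : V) : Finset V :=
  Finset.univ.filter fun j => G.toDigraph.Adj i j

/-- The vector field of the polynomial protocol. -/
noncomputable def polynomialProtocol (G : WeightedDigraph V) (x : V → ℝ) : V → ℝ :=
  fun i => -(∏ j ∈ G.outNbrs i, x i ^ G.w j i) + ∏ j ∈ G.inNbrs i, x j ^ G.w i j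

/-- The vector field of the entropic protocol. -/
noncomputable def entropicProtocol (G : WeightedDigraph V) (x : V → ℝ) : V → ℝ :=
  fun i => -∑ j ∈ G.inNbrs i, G.w i j * x i * Real.log (x i / x j)

/-- The vector field of the scaling-invariant protocol. -/
noncomputable def scalingInvariantProtocol (G : WeightedDigraph V) (x : V → ℝ) : V → ℝ :=
  fun i => ∑ j ∈ G.inNbrs i, G.w i j * (Real.log (x j) - Real.log (x i))

end WeightedDigraph

/-- `x` solves the autonomous system `ẋ = f x` on `[0, ∞)` with `x 0 = x₀`
(the derivative at time `0` being one-sided). -/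
def IsForwardSolution {V : Type*} [Fintype V] (f : (V → ℝ) → V → ℝ) (x₀ : V → ℝ)
    (x : ℝ → V → ℝ) : Prop :=
  x 0 = x₀ ∧ IsIntegralCurveOn x (fun _ => f) (Set.Ici 0)

/-- The trajectory `x` converges exponentially fast to the consensus state `xbar • 1`. -/
def ConvergesExponentiallyTo {V : Type*} (x : ℝ → V → ℝ) (xbar : ℝ) : Prop :=
  ∃ C lam : ℝ, 0 < lam ∧ ∀ t : ℝ, 0 ≤ t → ∀ i, |x t i - xbar| ≤ C * Real.exp (-lam * t)

/-- Exponential convergence to consensus of the protocol `ẋ = f x` on the positive orthant.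
From each positive initial state a solution exists for all `t ≥ 0`, and each such solution stays
positive and converges exponentially fast to an equilibrium `xbar • 1`, where `xbar` lies between
the extreme initial values, strictly so if the initial state is not itself a consensus state. -/
def ConvergesToConsensus {V : Type*} [Fintype V] [Nonempty V]
    (f : (V → ℝ) → V → ℝ) : Prop :=
  ∀ x₀ : V → ℝ, (∀ i, 0 < x₀ i) →
    (∃ x, IsForwardSolution f x₀ x) ∧
    ∀ x, IsForwardSolution f x₀ x →
      (∀ t : ℝ, 0 ≤ t → ∀ i, 0 < x t i) ∧
      ∃ xbar : ℝ, ConvergesExponentiallyTo x xbar ∧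
        (f fun _ => xbar) = 0 ∧
        Finset.univ.inf' Finset.univ_nonempty x₀ ≤ xbar ∧
        xbar ≤ Finset.univ.sup' Finset.univ_nonempty x₀ ∧
        ((∃ i j, x₀ i ≠ x₀ j) →
          Finset.univ.inf' Finset.univ_nonempty x₀ < xbar ∧
          xbar < Finset.univ.sup' Finset.univ_nonempty x₀)

/-! On a box `[m, M]^V` with `0 < m`, each protocol has the form `f x i = ∑ j, a j * (x j - x i)`,
with state-dependent `a j` lying between fixed positive multiples of `G.w i j` (`IsConsensusField`).
The mean value theorem for `log`, and for `exp` in the polynomial case, gives this form. Everything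
else uses only this form and Lipschitz continuity on boxes.

Extremal components cannot move outwards, so boxes are invariant (`IsForwardSolution.mem_Icc`); this
yields positivity and, by clamping the field to a box, global existence. If the state fills `[a,
b]`, both `x - a` and `b - x` are nonnegative averaging flows with mass `b - a` at some node. Strong
connectivity spreads this mass to every node within a uniform time `T`, leaving at least a fraction
`κ` everywhere (`exists_le_averagingFlow`). Hence both ends of the interval move inwards by `κ * (b
- a)`. Iterating this contraction gives nested intervals of geometrically decreasing length, whose
common point is the consensus value; the first contraction already makes the bounds on it strict.
Only derivatives are compared, so the weights need no regularity in time. -/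

open Set Filter Topology
open scoped NNReal

/-! ### Global existence and forward invariance of boxes -/

/-- The system `ẋ = f x` with bounded and Lipschitz `f` has global forward solutions. -/
theorem exists_isForwardSolution_of_lipschitzWith {V : Type*} [Fintype V]
    {f : (V → ℝ) → V → ℝ} {K L : ℝ≥0} (hf : LipschitzWith K f) (hL : ∀ x, ‖f x‖ ≤ L)
    (x₀ : V → ℝ) : ∃ x, IsForwardSolution f x₀ x := by
  have local_sol : ∀ n : ℕ, ∃ y : ℝ → V → ℝ, y 0 = x₀ ∧
      ∀ t ∈ Icc (0 : ℝ) n, HasDerivWithinAt y (f (y t)) (Icc (0 : ℝ) n) t := by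
    intro n
    -- Speed at most `L` means that a ball of radius `L * n` cannot be left before time `n`.
    have hp : IsPicardLindelof (fun _ => f) (tmin := 0) (tmax := n)
        ⟨0, left_mem_Icc.2 n.cast_nonneg⟩ x₀ (L * n) 0 L K := by
      refine IsPicardLindelof.of_time_independent (fun x _ => hL x) hf.lipschitzOnWith ?_
      simp
    exact hp.exists_eq_forall_mem_Icc_hasDerivWithinAt₀
  choose y hy0 hy using local_sol
  have agree : ∀ n k : ℕ, n ≤ k → EqOn (y n) (y k) (Icc (0 : ℝ) n) := by
    intro n k hnk
    have hsub : Icc (0 : ℝ) n ⊆ Icc (0 : ℝ) k := Icc_subset_Icc_right (by exact_mod_cast hnk)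
    have right : ∀ k : ℕ, ∀ t ∈ Ico (0 : ℝ) k,
        HasDerivWithinAt (y k) (f (y k t)) (Ici t) t := fun k t ht =>
      ((hy k t (Ico_subset_Icc_self ht)).mono (Icc_subset_Icc_left ht.1)).mono_of_mem_nhdsWithin
        (Icc_mem_nhdsGE ht.2)
    refine ODE_solution_unique (v := fun _ => f) (fun _ => hf)
      (fun t ht => (hy n t ht).continuousWithinAt) (right n)
      (fun t ht => (hy k t (hsub ht)).continuousWithinAt.mono hsub)
      (fun t ht => right k t ⟨ht.1, ht.2.trans_le (by exact_mod_cast hnk)⟩) ?_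
    rw [hy0, hy0]
  have glue : ∀ (n : ℕ) (t : ℝ), t ∈ Icc (0 : ℝ) n → y (⌈t⌉₊ + 1) t = y n t := by
    intro n t ht
    rcases le_total (⌈t⌉₊ + 1) n with h | h
    · refine agree _ _ h ⟨ht.1, (Nat.le_ceil t).trans ?_⟩
      push_cast
      linarith
    · exact (agree _ _ h ht).symm
  -- The `+ 1` keeps `t` strictly below the right endpoint, so that the interval is a neighbourhood
  -- of `t` within `Ici 0`.
  refine ⟨fun t => y (⌈t⌉₊ + 1) t, hy0 _, fun t ht => ?_⟩
  have ht0 : (0 : ℝ) ≤ t := ht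
  have hlt : t < ((⌈t⌉₊ + 1 : ℕ) : ℝ) := by
    push_cast
    linarith [Nat.le_ceil t]
  have hmem : Icc (0 : ℝ) ((⌈t⌉₊ + 1 : ℕ) : ℝ) ∈ 𝓝[Ici 0] t := by
    rw [← Ici_inter_Iic]
    exact inter_mem_nhdsWithin _ (Iic_mem_nhds hlt)
  have hd := (hy (⌈t⌉₊ + 1) t ⟨ht0, hlt.le⟩).mono_of_mem_nhdsWithin hmem
  refine hd.congr_of_eventuallyEq ?_ rfl
  filter_upwards [hmem] with s hs using glue _ s hs

/-- Barrier principle: away from contact continuity suffices, and at contact the strict inequality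
of slopes pushes `g` below `b`. -/
theorem eventually_nhdsGT_le_of_hasDerivWithinAt {g b : ℝ → ℝ} {g' b' t : ℝ}
    (hg : HasDerivWithinAt g g' (Ioi t) t) (hb : HasDerivWithinAt b b' (Ioi t) t)
    (hle : g t ≤ b t) (hlt : g t = b t → g' < b') : ∀ᶠ s in 𝓝[>] t, g s ≤ b s := by
  rcases hle.lt_or_eq with h | h
  · filter_upwards [hg.continuousWithinAt.eventually_lt hb.continuousWithinAt h] with s hs
      using hs.le
  · have := (hg.sub hb).limsup_slope_le' (lt_irrefl t) (sub_neg.2 (hlt h))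
    filter_upwards [this, self_mem_nhdsWithin] with s hs hts
    have hpos : 0 < s - t := sub_pos.2 hts
    rw [slope_def_field, div_lt_iff₀ hpos] at hs
    simp only [Pi.sub_apply] at hs
    linarith

theorem IsForwardSolution.hasDerivWithinAt_apply {V : Type*} [Fintype V]
    {f : (V → ℝ) → V → ℝ} {x₀ : V → ℝ} {x : ℝ → V → ℝ} (hx : IsForwardSolution f x₀ x)
    {t : ℝ} (ht : 0 ≤ t) (i : V) :
    HasDerivWithinAt (fun s => x s i) (f (x t) i) (Ici 0) t :=
  hasDerivWithinAt_pi.1 (hx.2 t ht) i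

theorem IsForwardSolution.shift {V : Type*} [Fintype V]
    {f : (V → ℝ) → V → ℝ} {x₀ : V → ℝ} {x : ℝ → V → ℝ} (hx : IsForwardSolution f x₀ x)
    {s : ℝ} (hs : 0 ≤ s) : IsForwardSolution f (x s) fun t => x (t + s) := by
  refine ⟨by simp, fun t ht => ?_⟩
  have ht0 : (0 : ℝ) ≤ t := ht
  have hd := hx.2 (t + s) (add_nonneg ht0 hs)
  have := hd.scomp t (h := fun r => r + s) (s := Ici 0)
    ((hasDerivWithinAt_id t _).add_const s) (fun r hr => add_nonneg (mem_Ici.1 hr) hs)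
  simpa [Function.comp_def] using this

/-- A field for which, at positive states, maximal components do not increase and minimal
components do not decrease leaves every box `[m, M]^V` with `0 < m` forward invariant. -/
theorem IsForwardSolution.mem_Icc {V : Type*} [Fintype V]
    {f : (V → ℝ) → V → ℝ}
    (hmax : ∀ x i, (∀ j, 0 < x j) → (∀ j, x j ≤ x i) → f x i ≤ 0)
    (hmin : ∀ x i, (∀ j, 0 < x j) → (∀ j, x i ≤ x j) → 0 ≤ f x i)
    {x₀ : V → ℝ} {x : ℝ → V → ℝ} (hx : IsForwardSolution f x₀ x) {m M : ℝ} (hm : 0 < m)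
    (h₀ : ∀ i, x₀ i ∈ Icc m M) {T : ℝ} (hT : 0 ≤ T) (i : V) : x T i ∈ Icc m M := by
  -- The hypotheses on `f` give only weak inequalities at the faces, so the box is widened at rate
  -- `ε` to make them strict. The condition `ε * (1 + T) < m` keeps the widened box positive; `ε`
  -- tends to `0` at the end.
  have key : ∀ ε > 0, ε * (1 + T) < m → ∀ t ∈ Icc 0 T, ∀ i,
      x t i ∈ Icc (m - ε * (1 + t)) (M + ε * (1 + t)) := by
    intro ε hε hεT
    have hcont : ∀ i, ContinuousOn (fun s => x s i) (Icc 0 T) := fun i t ht =>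
      (hx.hasDerivWithinAt_apply ht.1 i).continuousWithinAt.mono Icc_subset_Ici_self
    let S : Set ℝ := {t | ∀ i, x t i ∈ Icc (m - ε * (1 + t)) (M + ε * (1 + t))}
    have hclosed : IsClosed (S ∩ Icc 0 T) := by
      have : S ∩ Icc 0 T = Icc 0 T ∩ ⋂ i, ({t ∈ Icc 0 T | m - ε * (1 + t) ≤ x t i} ∩
          {t ∈ Icc 0 T | x t i ≤ M + ε * (1 + t)}) := by
        ext t
        simp only [S, mem_inter_iff, mem_ofPred_eq, mem_iInter, Set.mem_Icc]
        grind
      rw [this]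
      refine isClosed_Icc.inter (isClosed_iInter fun i => IsClosed.inter ?_ ?_)
      · exact isClosed_Icc.isClosed_le (by fun_prop) (hcont i)
      · exact isClosed_Icc.isClosed_le (hcont i) (by fun_prop)
    refine hclosed.Icc_subset_of_forall_mem_nhdsWithin ?_ ?_
    · intro i
      have := h₀ i
      rw [hx.1]
      exact ⟨by linarith [this.1], by linarith [this.2]⟩
    · rintro t ⟨htS, ht0, htT⟩
      have hpos : ∀ j, 0 < x t j := fun j => by
        have := (htS j).1
        have : ε * (1 + t) ≤ ε * (1 + T) := by gcongr
        linarith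
      have hlin : HasDerivWithinAt (fun s : ℝ => ε * (1 + s)) ε (Ioi t) t := by
        simpa using (((hasDerivAt_id t).const_add 1).const_mul ε).hasDerivWithinAt (s := Ioi t)
      have hd : ∀ i, HasDerivWithinAt (fun s => x s i) (f (x t) i) (Ioi t) t := fun i =>
        (hx.hasDerivWithinAt_apply ht0 i).mono (Ioi_subset_Ici_self.trans (Ici_subset_Ici.2 ht0))
      have ev : ∀ᶠ s in 𝓝[>] t, ∀ i, x s i ∈ Icc (m - ε * (1 + s)) (M + ε * (1 + s)) := by
        refine eventually_all.2 fun i => ?_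
        have lower : ∀ᶠ s in 𝓝[>] t, m - ε * (1 + s) ≤ x s i := by
          refine eventually_nhdsGT_le_of_hasDerivWithinAt (hlin.const_sub m) (hd i)
            (htS i).1 fun h => ?_
          have := hmin (x t) i hpos fun j => h ▸ (htS j).1
          linarith
        have upper : ∀ᶠ s in 𝓝[>] t, x s i ≤ M + ε * (1 + s) := by
          refine eventually_nhdsGT_le_of_hasDerivWithinAt (hd i) (hlin.const_add M)
            (htS i).2 fun h => ?_
          have := hmax (x t) i hpos fun j => h ▸ (htS j).2
          linarith
        filter_upwards [lower, upper] with s h1 h2 using ⟨h1, h2⟩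
      exact ev
  have hT1 : 0 < 1 + T := by linarith
  have bound : ∀ δ > 0, δ < m → m - δ ≤ x T i ∧ x T i ≤ M + δ := by
    intro δ hδ hδm
    have := key (δ / (1 + T)) (by positivity) (by rwa [div_mul_cancel₀ _ hT1.ne']) T
      (right_mem_Icc.2 hT) i
    rwa [div_mul_cancel₀ _ hT1.ne'] at this
  constructor
  · refine le_of_forall_pos_le_add fun δ hδ => ?_
    have := (bound (min δ (m / 2)) (by positivity) (by
      linarith [min_le_right δ (m / 2)])).1
    linarith [min_le_left δ (m / 2)]
  · refine le_of_forall_pos_le_add fun δ hδ => ?_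
    have := (bound (min δ (m / 2)) (by positivity) (by
      linarith [min_le_right δ (m / 2)])).2
    linarith [min_le_left δ (m / 2)]

/-! ### Averaging fields and the spreading of mass along paths -/

/-- A vector field that, on each box `[m, M]^V` in the positive orthant, is Lipschitz and is a
state-dependent averaging field whose weights are uniformly comparable to those of `G`. -/
structure IsConsensusField {V : Type*} [Fintype V] (G : WeightedDigraph V)
    (f : (V → ℝ) → V → ℝ) : Prop where
  lipschitz : ∀ m M : ℝ, 0 < m → ∃ K, LipschitzOnWith K f {x | ∀ i, x i ∈ Icc m M}
  averaging : ∀ m M : ℝ, 0 < m → ∃ α β : ℝ, 0 < α ∧ 0 ≤ β ∧ ∀ x : V → ℝ,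
    (∀ i, x i ∈ Icc m M) → ∀ i, ∃ a : V → ℝ,
      (∀ j, α * G.w i j ≤ a j ∧ a j ≤ β * G.w i j) ∧ f x i = ∑ j, a j * (x j - x i)

/-- A nonnegative trajectory of a time-dependent averaging system whose weights lie between
`α` and `β` times those of `G`. -/
def IsAveragingFlow {V : Type*} [Fintype V] (G : WeightedDigraph V) (α β : ℝ)
    (u : ℝ → V → ℝ) : Prop :=
  ∀ t, 0 ≤ t → ∀ i, 0 ≤ u t i ∧ ∃ a : V → ℝ,
    (∀ j, α * G.w i j ≤ a j ∧ a j ≤ β * G.w i j) ∧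
      HasDerivWithinAt (fun s => u s i) (∑ j, a j * (u t j - u t i)) (Ici 0) t

namespace IsAveragingFlow

variable {V : Type*} [Fintype V] {G : WeightedDigraph V} {α β : ℝ} {u : ℝ → V → ℝ}

/-- The rate `β * ∑ k, ∑ l, G.w k l` dominates `∑ j, a j`, so this integrating factor absorbs the
loss term `-(∑ j, a j) * u t i`. Only nonnegative inflow terms remain, and each of them bounds the
derivative from below. -/
theorem exists_hasDerivWithinAt_exp_mul (hu : IsAveragingFlow G α β u) (hα : 0 ≤ α) (hβ : 0 ≤ β)
    {t : ℝ} (ht : 0 ≤ t) (i : V) :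
    ∃ d, HasDerivWithinAt (fun s => Real.exp (β * (∑ k, ∑ l, G.w k l) * s) * u s i) d (Ici 0) t ∧
      ∀ j, α * G.w i j * (Real.exp (β * (∑ k, ∑ l, G.w k l) * t) * u t j) ≤ d := by
  obtain ⟨-, a, ha, hd⟩ := hu t ht i
  set D := β * ∑ k, ∑ l, G.w k l with hD
  have hexp : HasDerivWithinAt (fun s => Real.exp (D * s)) (Real.exp (D * t) * D) (Ici 0) t := by
    simpa using (((hasDerivAt_id t).const_mul D).exp).hasDerivWithinAt (s := Ici 0)
  refine ⟨_, hexp.mul hd, fun j => ?_⟩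
  have ha0 : ∀ j, 0 ≤ a j := fun j => (mul_nonneg hα (G.nonneg i j)).trans (ha j).1
  have hsumle : ∑ j, a j ≤ D := calc
    ∑ j, a j ≤ ∑ j, β * G.w i j := Finset.sum_le_sum fun j _ => (ha j).2
    _ = β * ∑ j, G.w i j := (Finset.mul_sum ..).symm
    _ ≤ D := mul_le_mul_of_nonneg_left (Finset.single_le_sum (f := fun k => ∑ l, G.w k l)
      (fun k _ => Finset.sum_nonneg fun l _ => G.nonneg k l) (Finset.mem_univ i)) hβ
  have hsingle : a j * u t j ≤ ∑ j, a j * u t j :=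
    Finset.single_le_sum (f := fun j => a j * u t j)
      (fun k _ => mul_nonneg (ha0 k) (hu t ht k).1) (Finset.mem_univ j)
  have hsplit : ∑ j, a j * (u t j - u t i) = ∑ j, a j * u t j - (∑ j, a j) * u t i := by
    simp only [mul_sub, Finset.sum_sub_distrib, Finset.sum_mul]
  have h1 : (∑ j, a j) * u t i ≤ D * u t i := mul_le_mul_of_nonneg_right hsumle (hu t ht i).1
  have h2 : α * G.w i j * u t j ≤ a j * u t j :=
    mul_le_mul_of_nonneg_right (ha j).1 (hu t ht j).1
  have hE := Real.exp_pos (D * t)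
  rw [hsplit]
  have : α * G.w i j * u t j ≤ D * u t i + (∑ j, a j * u t j - (∑ j, a j) * u t i) := by linarith
  nlinarith [mul_le_mul_of_nonneg_left this hE.le]

/-- Integrated form of the preceding bound; the feeding node may vary with `s`. With `c = 0` it says
that the rescaled components are nondecreasing. -/
theorem add_mul_le (hu : IsAveragingFlow G α β u) (hα : 0 ≤ α) (hβ : 0 ≤ β) {i : V} {c r t : ℝ}
    (hr : 0 ≤ r) (hrt : r ≤ t)
    (hc : ∀ s, r ≤ s → ∃ j, c ≤ α * G.w i j * (Real.exp (β * (∑ k, ∑ l, G.w k l) * s) * u s j)) :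
    Real.exp (β * (∑ k, ∑ l, G.w k l) * r) * u r i + c * (t - r) ≤
      Real.exp (β * (∑ k, ∑ l, G.w k l) * t) * u t i := by
  have hder := fun s (hs : 0 ≤ s) => hu.exists_hasDerivWithinAt_exp_mul hα hβ hs i
  set v := fun s => Real.exp (β * (∑ k, ∑ l, G.w k l) * s) * u s i
  choose! d hd hle using hder
  have hline : ∀ s, HasDerivAt (fun s => v r + c * (s - r)) c s := fun s => by
    simpa using (((hasDerivAt_id s).sub_const r).const_mul c).const_add (v r)
  refine image_le_of_deriv_right_le_deriv_boundary (a := r) (b := t)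
    (f := fun s => v r + c * (s - r)) (B := v) (by fun_prop)
    (fun s _ => (hline s).hasDerivWithinAt) (by simp)
    (fun s hs => (hd s (hr.trans hs.1)).continuousWithinAt.mono
      (Icc_subset_Ici_self.trans (Ici_subset_Ici.2 hr)))
    (fun s hs => (hd s (hr.trans hs.1)).mono (Ici_subset_Ici.2 (hr.trans hs.1))) ?_
    (right_mem_Icc.2 hrt)
  intro s hs
  obtain ⟨j, hj⟩ := hc s hs.1
  exact hj.trans (hle s (hr.trans hs.1) j)

end IsAveragingFlow

/-- Positive mass at `j` spreads along directed paths. -/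
theorem WeightedDigraph.exists_le_averagingFlow_of_path {V : Type*} [Fintype V]
    (G : WeightedDigraph V) {α β : ℝ} (hα : 0 < α) (hβ : 0 ≤ β) {j i : V}
    (h : Relation.ReflTransGen G.toDigraph.Adj j i) :
    ∃ T c : ℝ, 0 ≤ T ∧ 0 < c ∧ ∀ u, IsAveragingFlow G α β u → ∀ t, T ≤ t →
      c * u 0 j ≤ Real.exp (β * (∑ k, ∑ l, G.w k l) * t) * u t i := by
  induction h with
  | refl =>
    refine ⟨0, 1, le_rfl, one_pos, fun u hu t ht => ?_⟩
    have := hu.add_mul_le (i := j) (c := 0) hα.le hβ le_rfl ht fun s hs => ⟨j,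
      mul_nonneg (mul_nonneg hα.le (G.nonneg _ _)) (mul_nonneg (Real.exp_pos _).le (hu s hs j).1)⟩
    simpa using this
  | @tail k i _ hki ih =>
    obtain ⟨T, c, hT, hc, ih⟩ := ih
    have hw : 0 < G.w i k := hki
    -- After time `T` the rescaled component at `i` grows at least at rate `α * G.w i k * (c * u 0
    -- j)`; one further unit of time accumulates that amount.
    refine ⟨T + 1, α * G.w i k * c, by linarith, by positivity, fun u hu t ht => ?_⟩
    have hTt : T ≤ t := by linarith
    have hstep := hu.add_mul_le (i := i) (c := α * G.w i k * (c * u 0 j)) hα.le hβ hT hTt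
      fun s hs => ⟨k, mul_le_mul_of_nonneg_left (ih u hu s hs) (by positivity)⟩
    have h0 : 0 ≤ Real.exp (β * (∑ k, ∑ l, G.w k l) * T) * u T i :=
      mul_nonneg (Real.exp_pos _).le (hu T hT i).1
    have h1 : 0 ≤ α * G.w i k * (c * u 0 j) :=
      mul_nonneg (by positivity) (mul_nonneg hc.le (hu 0 le_rfl j).1)
    nlinarith

/-- In a strongly connected digraph, mass at any node is felt at all nodes after a uniform time,
by a uniform fraction. -/
theorem WeightedDigraph.StronglyConnected.exists_le_averagingFlow {V : Type*} [Fintype V]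
    {G : WeightedDigraph V} (hG : G.StronglyConnected) {α β : ℝ} (hα : 0 < α) (hβ : 0 ≤ β) :
    ∃ T κ : ℝ, 0 < T ∧ 0 < κ ∧ κ < 1 ∧ ∀ u, IsAveragingFlow G α β u → ∀ i j,
      κ * u 0 j ≤ u T i := by
  choose T c hT hc h using fun j i => G.exists_le_averagingFlow_of_path hα hβ (hG j i)
  obtain ⟨S, hS⟩ : ∃ S, ∀ p : V × V, T p.1 p.2 ≤ S := Finite.exists_le _
  obtain ⟨C, hC⟩ : ∃ C, ∀ p : V × V, (c p.1 p.2)⁻¹ ≤ C := Finite.exists_le _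
  set D := β * ∑ k, ∑ l, G.w k l
  -- The `1` makes the time positive, and the `2` in `B` forces `κ < 1`.
  set R := max S 1
  set B := max C 2
  have hB : 0 < B := lt_of_lt_of_le two_pos (le_max_right _ _)
  have hD : 0 ≤ D := mul_nonneg hβ (Finset.sum_nonneg fun _ _ => Finset.sum_nonneg fun _ _ =>
    G.nonneg _ _)
  have hR : 0 < R := lt_of_lt_of_le one_pos (le_max_right _ _)
  refine ⟨R, B⁻¹ * Real.exp (-(D * R)), hR, by positivity, ?_, fun u hu i j => ?_⟩
  · have h1 : B⁻¹ < 1 := inv_lt_one_of_one_lt₀ (one_lt_two.trans_le (le_max_right _ _))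
    have h2 : Real.exp (-(D * R)) ≤ 1 := Real.exp_le_one_iff.2 (by nlinarith)
    nlinarith [Real.exp_pos (-(D * R))]
  · have h1 := h j i u hu R ((hS (j, i)).trans (le_max_left _ _))
    have h2 : B⁻¹ ≤ c j i := inv_le_of_inv_le₀ (hc j i) ((hC (j, i)).trans (le_max_left _ _))
    have h3 : B⁻¹ * u 0 j ≤ Real.exp (D * R) * u R i :=
      (mul_le_mul_of_nonneg_right h2 (hu 0 le_rfl j).1).trans h1
    calc B⁻¹ * Real.exp (-(D * R)) * u 0 j = Real.exp (-(D * R)) * (B⁻¹ * u 0 j) := by ring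
      _ ≤ Real.exp (-(D * R)) * (Real.exp (D * R) * u R i) := by gcongr
      _ = u R i := by rw [← mul_assoc, ← Real.exp_add]; simp

/-! ### Existence and contraction for consensus fields -/

namespace IsConsensusField

variable {V : Type*} [Fintype V] {G : WeightedDigraph V} {f : (V → ℝ) → V → ℝ}

theorem exists_box {x : V → ℝ} (hx : ∀ j, 0 < x j) : ∃ m M, 0 < m ∧ ∀ i, x i ∈ Icc m M := by
  obtain ⟨M, hM⟩ := Finite.exists_le x
  obtain ⟨C, hC⟩ := Finite.exists_le fun i => (x i)⁻¹
  refine ⟨(max C 1)⁻¹, M, inv_pos.2 (lt_of_lt_of_le one_pos (le_max_right _ _)), fun i => ⟨?_, hM i⟩⟩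
  exact inv_le_of_inv_le₀ (hx i) ((hC i).trans (le_max_left _ _))

theorem nonpos_of_max (hf : IsConsensusField G f) (x : V → ℝ) (i : V) (hx : ∀ j, 0 < x j)
    (hi : ∀ j, x j ≤ x i) : f x i ≤ 0 := by
  obtain ⟨m, M, hm, hbox⟩ := exists_box hx
  obtain ⟨α, β, hα, -, h⟩ := hf.averaging m M hm
  obtain ⟨a, ha, hfa⟩ := h x hbox i
  rw [hfa]
  exact Finset.sum_nonpos fun j _ => mul_nonpos_of_nonneg_of_nonpos
    ((mul_nonneg hα.le (G.nonneg i j)).trans (ha j).1) (sub_nonpos.2 (hi j))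

theorem nonneg_of_min (hf : IsConsensusField G f) (x : V → ℝ) (i : V) (hx : ∀ j, 0 < x j)
    (hi : ∀ j, x i ≤ x j) : 0 ≤ f x i := by
  obtain ⟨m, M, hm, hbox⟩ := exists_box hx
  obtain ⟨α, β, hα, -, h⟩ := hf.averaging m M hm
  obtain ⟨a, ha, hfa⟩ := h x hbox i
  rw [hfa]
  exact Finset.sum_nonneg fun j _ => mul_nonneg
    ((mul_nonneg hα.le (G.nonneg i j)).trans (ha j).1) (sub_nonneg.2 (hi j))

theorem mem_Icc (hf : IsConsensusField G f) {x₀ : V → ℝ} {x : ℝ → V → ℝ}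
    (hx : IsForwardSolution f x₀ x) {m M : ℝ} (hm : 0 < m) (h₀ : ∀ i, x₀ i ∈ Icc m M)
    {t : ℝ} (ht : 0 ≤ t) (i : V) : x t i ∈ Icc m M :=
  hx.mem_Icc hf.nonpos_of_max hf.nonneg_of_min hm h₀ ht i

theorem exists_isForwardSolution [Nonempty V] (hf : IsConsensusField G f) {x₀ : V → ℝ}
    (hx₀ : ∀ i, 0 < x₀ i) : ∃ x, IsForwardSolution f x₀ x := by
  obtain ⟨m, M, hm, hbox⟩ := exists_box hx₀
  have hmM : m ≤ M := (hbox (Classical.arbitrary V)).1.trans (hbox (Classical.arbitrary V)).2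
  -- Composition with the retraction onto the box makes `f` globally Lipschitz and bounded without
  -- changing it on the box.
  let clamp : (V → ℝ) → V → ℝ := fun x i => max m (min M (x i))
  have clamp_mem : ∀ x i, clamp x i ∈ Icc m M := fun x i =>
    ⟨le_max_left _ _, max_le hmM (min_le_left _ _)⟩
  have clamp_eq : ∀ x : V → ℝ, (∀ i, x i ∈ Icc m M) → clamp x = x := fun x hx => by
    ext i
    simp only [clamp, min_eq_right (hx i).2, max_eq_right (hx i).1]
  have clamp_lip : LipschitzWith 1 clamp := by
    refine LipschitzWith.of_dist_le_mul fun x y => ?_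
    rw [NNReal.coe_one, one_mul]
    refine (dist_pi_le_iff dist_nonneg).2 fun i => le_trans ?_ (dist_le_pi_dist x y i)
    have h : LipschitzWith 1 fun r : ℝ => max m (min M r) :=
      (LipschitzWith.id.const_min M).const_max m
    simpa using h.dist_le_mul (x i) (y i)
  obtain ⟨K, hK⟩ := hf.lipschitz m M hm
  have hlip : LipschitzWith (K * 1) (f ∘ clamp) := by
    rw [← lipschitzOnWith_univ]
    exact hK.comp clamp_lip.lipschitzOnWith fun x _ => clamp_mem x
  have hbound : ∃ L : ℝ≥0, ∀ x, ‖(f ∘ clamp) x‖ ≤ L := by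
    have hcomp : IsCompact {x : V → ℝ | ∀ i, x i ∈ Icc m M} := by
      simpa [Set.pi] using isCompact_univ_pi fun _ : V => isCompact_Icc (a := m) (b := M)
    obtain ⟨L, hL⟩ := hcomp.exists_bound_of_continuousOn hK.continuousOn
    refine ⟨L.toNNReal, fun x => (hL _ (clamp_mem x)).trans (Real.le_coe_toNNReal L)⟩
  obtain ⟨L, hL⟩ := hbound
  obtain ⟨x, hx⟩ := exists_isForwardSolution_of_lipschitzWith hlip hL x₀
  refine ⟨x, hx.1, fun t ht => ?_⟩
  -- Clamping is monotone in each component, so extremal components stay extremal and the box is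
  -- invariant for the clamped field too.
  have hmem : ∀ i, x t i ∈ Icc m M := hx.mem_Icc
    (fun x i _ hi => hf.nonpos_of_max _ i (fun j => hm.trans_le (clamp_mem x j).1)
      fun j => max_le_max_left m (min_le_min_left M (hi j)))
    (fun x i _ hi => hf.nonneg_of_min _ i (fun j => hm.trans_le (clamp_mem x j).1)
      fun j => max_le_max_left m (min_le_min_left M (hi j))) hm hbox ht
  have := hx.2 t ht
  simpa only [Function.comp_apply, clamp_eq _ hmem] using this

/-- The mass of `x - a` at a maximal node lifts every component, and that of `b - x` at a minimal
node lowers every component. `T` and `κ` depend only on the outer box `[m, M]`, which is what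
permits iteration. -/
theorem exists_contraction (hf : IsConsensusField G f) (hG : G.StronglyConnected)
    {m M : ℝ} (hm : 0 < m) : ∃ T κ : ℝ, 0 < T ∧ 0 < κ ∧ κ < 1 ∧
      ∀ (x₀ : V → ℝ) (x : ℝ → V → ℝ) (a b : ℝ), IsForwardSolution f x₀ x → m ≤ a → b ≤ M →
        (∀ i, x₀ i ∈ Icc a b) → (∃ i, x₀ i = a) → (∃ i, x₀ i = b) →
        ∀ i, x T i ∈ Icc (a + κ * (b - a)) (b - κ * (b - a)) := by
  obtain ⟨α, β, hα, hβ, h⟩ := hf.averaging m M hm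
  obtain ⟨T, κ, hT, hκ, hκ1, hflow⟩ := hG.exists_le_averagingFlow hα hβ
  refine ⟨T, κ, hT, hκ, hκ1, ?_⟩
  rintro x₀ x a b hx hma hbM hbox ⟨p, hp⟩ ⟨q, hq⟩ i
  have hab : ∀ t, 0 ≤ t → ∀ i, x t i ∈ Icc a b := fun t ht =>
    hf.mem_Icc hx (hm.trans_le hma) hbox ht
  have hmM : ∀ t, 0 ≤ t → ∀ i, x t i ∈ Icc m M := fun t ht i =>
    Icc_subset_Icc hma hbM (hab t ht i)
  have low : IsAveragingFlow G α β fun t i => x t i - a := fun t ht i => by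
    refine ⟨sub_nonneg.2 (hab t ht i).1, ?_⟩
    obtain ⟨w, hw, hfw⟩ := h (x t) (hmM t ht) i
    refine ⟨w, hw, ?_⟩
    have := (hx.hasDerivWithinAt_apply ht i).sub_const a
    simpa [hfw] using this
  have high : IsAveragingFlow G α β fun t i => b - x t i := fun t ht i => by
    refine ⟨sub_nonneg.2 (hab t ht i).2, ?_⟩
    obtain ⟨w, hw, hfw⟩ := h (x t) (hmM t ht) i
    refine ⟨w, hw, ?_⟩
    refine ((hx.hasDerivWithinAt_apply ht i).const_sub b).congr_deriv ?_
    rw [hfw, ← Finset.sum_neg_distrib]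
    exact Finset.sum_congr rfl fun j _ => by ring
  have h1 := hflow _ low i q
  have h2 := hflow _ high i p
  simp only [hx.1, hp, hq] at h1 h2
  constructor <;> linarith

theorem apply_const (hf : IsConsensusField G f) {c : ℝ} (hc : 0 < c) : (f fun _ => c) = 0 := by
  ext i
  exact le_antisymm (hf.nonpos_of_max _ i (fun _ => hc) fun _ => le_rfl)
    (hf.nonneg_of_min _ i (fun _ => hc) fun _ => le_rfl)

end IsConsensusField

/-! ### Exponential convergence to consensus -/

/-- If `q ∈ (0, 1)`, geometric decay along the grid `T ℕ` is exponential decay. -/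
theorem pow_floor_div_le_exp {q T t : ℝ} (hq : 0 < q) (hq1 : q < 1) (hT : 0 < T) :
    q ^ ⌊t / T⌋₊ ≤ q⁻¹ * Real.exp (-(-Real.log q / T) * t) := by
  have hlog : Real.log q < 0 := Real.log_neg hq hq1
  have h1 : t / T - 1 ≤ (⌊t / T⌋₊ : ℝ) := by linarith [Nat.lt_floor_add_one (t / T)]
  calc q ^ ⌊t / T⌋₊ = Real.exp (Real.log q * ⌊t / T⌋₊) := by
        rw [← Real.rpow_natCast, Real.rpow_def_of_pos hq]
    _ ≤ Real.exp (Real.log q * (t / T - 1)) := Real.exp_le_exp.2 (by nlinarith)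
    _ = Real.exp (-Real.log q) * Real.exp (-(-Real.log q / T) * t) := by
        rw [← Real.exp_add]
        congr 1
        field_simp
        ring
    _ = q⁻¹ * Real.exp (-(-Real.log q / T) * t) := by
        rw [Real.exp_neg, Real.exp_log hq]

theorem IsConsensusField.convergesToConsensus {V : Type*} [Fintype V] [Nonempty V]
    {G : WeightedDigraph V} {f : (V → ℝ) → V → ℝ} (hf : IsConsensusField G f)
    (hG : G.StronglyConnected) : ConvergesToConsensus f := by
  intro x₀ hx₀
  refine ⟨hf.exists_isForwardSolution hx₀, fun x hx => ?_⟩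
  let lo : (V → ℝ) → ℝ := fun y => Finset.univ.inf' Finset.univ_nonempty y
  let hi : (V → ℝ) → ℝ := fun y => Finset.univ.sup' Finset.univ_nonempty y
  have mem_lohi : ∀ y i, y i ∈ Icc (lo y) (hi y) := fun y i =>
    ⟨Finset.inf'_le _ (Finset.mem_univ i), Finset.le_sup' _ (Finset.mem_univ i)⟩
  have lo_att : ∀ y, ∃ i, y i = lo y := fun y => by
    obtain ⟨i, -, hi⟩ := Finset.exists_mem_eq_inf' Finset.univ_nonempty y
    exact ⟨i, hi.symm⟩
  have hi_att : ∀ y, ∃ i, y i = hi y := fun y => by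
    obtain ⟨i, -, hi⟩ := Finset.exists_mem_eq_sup' Finset.univ_nonempty y
    exact ⟨i, hi.symm⟩
  have hm : 0 < lo x₀ := by
    obtain ⟨i, h⟩ := lo_att x₀
    exact h ▸ hx₀ i
  have hbox : ∀ t, 0 ≤ t → ∀ i, x t i ∈ Icc (lo x₀) (hi x₀) := fun t ht =>
    hf.mem_Icc hx hm (mem_lohi x₀) ht
  have lo_le : ∀ t, 0 ≤ t → lo x₀ ≤ lo (x t) := fun t ht => by
    obtain ⟨i, h⟩ := lo_att (x t)
    exact h ▸ (hbox t ht i).1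
  have hi_le : ∀ t, 0 ≤ t → hi (x t) ≤ hi x₀ := fun t ht => by
    obtain ⟨i, h⟩ := hi_att (x t)
    exact h ▸ (hbox t ht i).2
  obtain ⟨T, κ, hT, hκ, hκ1, hcontr⟩ := hf.exists_contraction hG (m := lo x₀) (M := hi x₀) hm
  have step : ∀ s, 0 ≤ s → ∀ i, x (T + s) i ∈
      Icc (lo (x s) + κ * (hi (x s) - lo (x s))) (hi (x s) - κ * (hi (x s) - lo (x s))) :=
    fun s hs => hcontr (x s) _ _ _ (hx.shift hs) (lo_le s hs) (hi_le s hs) (mem_lohi _)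
      (lo_att _) (hi_att _)
  have lohi : ∀ y, lo y ≤ hi y := fun y =>
    (mem_lohi y (Classical.arbitrary V)).1.trans (mem_lohi y (Classical.arbitrary V)).2
  have grid : ∀ k : ℕ, (0 : ℝ) ≤ k * T := fun k => by positivity
  have grid_succ : ∀ k : ℕ, ((k + 1 : ℕ) : ℝ) * T = T + k * T := fun k => by
    push_cast
    ring
  have lo_step : ∀ k : ℕ, lo (x (k * T)) + κ * (hi (x (k * T)) - lo (x (k * T))) ≤
      lo (x ((k + 1 : ℕ) * T)) := fun k => by
    obtain ⟨i, h⟩ := lo_att (x ((k + 1 : ℕ) * T))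
    rw [← h, grid_succ]
    exact (step _ (grid k) i).1
  have hi_step : ∀ k : ℕ, hi (x ((k + 1 : ℕ) * T)) ≤
      hi (x (k * T)) - κ * (hi (x (k * T)) - lo (x (k * T))) := fun k => by
    obtain ⟨i, h⟩ := hi_att (x ((k + 1 : ℕ) * T))
    rw [← h, grid_succ]
    exact (step _ (grid k) i).2
  have gap : ∀ k : ℕ, 0 ≤ κ * (hi (x (k * T)) - lo (x (k * T))) := fun k =>
    mul_nonneg hκ.le (sub_nonneg.2 (lohi _))
  have lo_mono : Monotone fun k : ℕ => lo (x (k * T)) :=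
    monotone_nat_of_le_succ fun k => by linarith [lo_step k, gap k]
  have hi_anti : Antitone fun k : ℕ => hi (x (k * T)) :=
    antitone_nat_of_succ_le fun k => by linarith [hi_step k, gap k]
  -- One step in fact gives the factor `1 - 2 * κ`; the weaker `1 - κ` is certainly positive, as the
  -- passage to an exponential requires.
  have diam : ∀ k : ℕ, hi (x (k * T)) - lo (x (k * T)) ≤ (1 - κ) ^ k * (hi x₀ - lo x₀) := by
    intro k
    induction k with
    | zero => simp [hx.1]
    | succ k ih =>
      have := mul_le_mul_of_nonneg_left ih (sub_nonneg.2 hκ1.le)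
      rw [pow_succ']
      linarith [lo_step k, hi_step k, gap k]
  -- The consensus value is the common point of the nested intervals `[lo, hi]` along the grid.
  have hxbar := lo_mono.ciSup_mem_iInter_Icc_of_antitone hi_anti fun k => lohi _
  set xbar := ⨆ k : ℕ, lo (x (k * T))
  rw [mem_iInter] at hxbar
  have h0 := hxbar 0
  have h1 := hxbar 1
  have l1 := lo_step 0
  have u1 := hi_step 0
  simp only [Nat.cast_zero, zero_mul, zero_add, hx.1] at h0 h1 l1 u1
  have hpos : 0 < xbar := hm.trans_le h0.1
  refine ⟨fun t ht i => hm.trans_le (hbox t ht i).1, xbar, ?_, hf.apply_const hpos, h0.1, h0.2, ?_⟩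
  · have hlog : Real.log (1 - κ) < 0 := Real.log_neg (by linarith) (by linarith)
    refine ⟨(1 - κ)⁻¹ * (hi x₀ - lo x₀), -Real.log (1 - κ) / T, by
      exact div_pos (neg_pos.2 hlog) hT, fun t ht i => ?_⟩
    set k := ⌊t / T⌋₊
    have hkt : k * T ≤ t := (le_div_iff₀ hT).1 (Nat.floor_le (div_nonneg ht hT.le))
    have hxt : x t i ∈ Icc (lo (x (k * T))) (hi (x (k * T))) := by
      -- Between grid times, the box of the last grid point is still invariant.
      have := hf.mem_Icc (hx.shift (grid k)) (hm.trans_le (lo_le _ (grid k))) (mem_lohi _)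
        (sub_nonneg.2 hkt) i
      simpa using this
    calc |x t i - xbar| ≤ hi (x (k * T)) - lo (x (k * T)) :=
          abs_sub_le_of_le_of_le hxt.1 hxt.2 (hxbar k).1 (hxbar k).2
      _ ≤ (1 - κ) ^ k * (hi x₀ - lo x₀) := diam k
      _ ≤ (1 - κ)⁻¹ * Real.exp (-(-Real.log (1 - κ) / T) * t) * (hi x₀ - lo x₀) :=
          mul_le_mul_of_nonneg_right (pow_floor_div_le_exp (by linarith) (by linarith) hT)
            (sub_nonneg.2 (lohi _))
      _ = _ := by ring
  · rintro ⟨i, j, hij⟩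
    have hlt : lo x₀ < hi x₀ := by
      refine (lohi x₀).lt_of_ne fun h => hij ?_
      have hi' := mem_lohi x₀ i
      have hj' := mem_lohi x₀ j
      rw [← h, Icc_self] at hi' hj'
      exact hi'.trans hj'.symm
    -- `xbar` lies in the interval at grid time `T`, which is strictly inside the initial one.
    have : 0 < κ * (hi x₀ - lo x₀) := mul_pos hκ (sub_pos.2 hlt)
    exact ⟨by change lo x₀ < _; linarith [h1.1], by change _ < hi x₀; linarith [h1.2]⟩

/-! ### The three protocols as consensus fields -/

/-- Mean value theorem on an interval, for endpoints in any order. -/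
theorem exists_sub_eq_mul_sub_of_hasDerivAt {φ φ' : ℝ → ℝ} {l r : ℝ}
    (hd : ∀ x ∈ Icc l r, HasDerivAt φ (φ' x) x) {a b : ℝ} (ha : a ∈ Icc l r) (hb : b ∈ Icc l r) :
    ∃ ξ ∈ Icc l r, φ b - φ a = φ' ξ * (b - a) := by
  wlog hab : a < b generalizing a b
  · rcases (not_lt.1 hab).eq_or_lt with rfl | h
    · exact ⟨b, hb, by simp⟩
    · obtain ⟨ξ, hξ, he⟩ := this hb ha h
      exact ⟨ξ, hξ, by linarith⟩
  have hsub : Icc a b ⊆ Icc l r := Icc_subset_Icc ha.1 hb.2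
  obtain ⟨ξ, hξ, he⟩ := exists_hasDerivAt_eq_slope φ φ' hab
    (fun x hx => (hd x (hsub hx)).continuousAt.continuousWithinAt)
    fun x hx => hd x (hsub (Ioo_subset_Icc_self hx))
  refine ⟨ξ, hsub (Ioo_subset_Icc_self hξ), ?_⟩
  rw [he, div_mul_cancel₀ _ (sub_pos.2 hab).ne']

theorem contDiffOn_log_apply {V : Type*} [Fintype V] (i : V) :
    ContDiffOn ℝ 1 (fun x : V → ℝ => Real.log (x i)) {x | ∀ i, 0 < x i} :=
  (contDiff_apply ℝ ℝ i).contDiffOn.log fun _ hx => (hx i).ne'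

namespace WeightedDigraph

variable {V : Type*} [Fintype V] (G : WeightedDigraph V)

open scoped Classical in
theorem sum_inNbrs {g : V → ℝ} {i : V} (hg : ∀ j, G.w i j = 0 → g j = 0) :
    ∑ j ∈ G.inNbrs i, g j = ∑ j, g j :=
  Finset.sum_filter_of_ne fun j _ hj =>
    show 0 < G.w i j from (G.nonneg i j).lt_of_ne fun h => hj (hg j h.symm)

open scoped Classical in
theorem sum_outNbrs {g : V → ℝ} {i : V} (hg : ∀ j, G.w j i = 0 → g j = 0) :
    ∑ j ∈ G.outNbrs i, g j = ∑ j, g j :=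
  Finset.sum_filter_of_ne fun j _ hj =>
    show 0 < G.w j i from (G.nonneg j i).lt_of_ne fun h => hj (hg j h.symm)

variable {G}

/-- A smooth field that is a state-dependent positive multiple of the logarithmic disagreement
`∑ j, w i j * (log (x j) - log (x i))` is a consensus field. -/
theorem isConsensusField_of_log {f : (V → ℝ) → V → ℝ}
    (hs : ∀ i, ContDiffOn ℝ 1 (fun x => f x i) {x | ∀ i, 0 < x i})
    (hf : ∀ m M : ℝ, 0 < m → ∃ α β : ℝ, 0 < α ∧ 0 ≤ β ∧ ∀ x : V → ℝ, (∀ i, x i ∈ Icc m M) →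
      ∀ i, ∃ g ∈ Icc α β, f x i = g * ∑ j, G.w i j * (Real.log (x j) - Real.log (x i))) :
    IsConsensusField G f where
  lipschitz m M hm := by
    have hbox : {x : V → ℝ | ∀ i, x i ∈ Icc m M} = Set.univ.pi fun _ => Icc m M := by
      ext
      simp only [mem_ofPred_eq, mem_univ_pi]
    refine ((contDiffOn_pi.2 hs).mono fun x hx i => hm.trans_le (hx i).1).exists_lipschitzOnWith
      one_ne_zero ?_ ?_ <;> rw [hbox]
    · exact convex_pi fun _ _ => convex_Icc m M
    · exact isCompact_univ_pi fun _ => isCompact_Icc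
  averaging m M hm := by
    obtain ⟨α, β, hα, hβ, h⟩ := hf m M hm
    -- `M < m` is allowed (the box is then empty), so `M` itself need not be positive.
    have hN : 0 < max m M := hm.trans_le (le_max_left _ _)
    refine ⟨α * (max m M)⁻¹, β * m⁻¹, by positivity, by positivity, fun x hx i => ?_⟩
    obtain ⟨g, hg, hfg⟩ := h x hx i
    have hslope : ∀ j, ∃ ξ ∈ Icc m M,
        Real.log (x j) - Real.log (x i) = ξ⁻¹ * (x j - x i) := fun j =>
      exists_sub_eq_mul_sub_of_hasDerivAt
        (fun y hy => Real.hasDerivAt_log (hm.trans_le hy.1).ne') (hx i) (hx j)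
    choose ξ hξ hlog using hslope
    have hg0 : 0 ≤ g := hα.le.trans hg.1
    have hw := G.nonneg i
    refine ⟨fun j => g * (ξ j)⁻¹ * G.w i j, fun j => ⟨?_, ?_⟩, ?_⟩
    · have hξ0 : 0 < ξ j := hm.trans_le (hξ j).1
      have : (max m M)⁻¹ ≤ (ξ j)⁻¹ := inv_anti₀ hξ0 ((hξ j).2.trans (le_max_right _ _))
      exact mul_le_mul_of_nonneg_right (mul_le_mul hg.1 this (inv_pos.2 hN).le hg0) (hw j)
    · have : (ξ j)⁻¹ ≤ m⁻¹ := inv_anti₀ hm (hξ j).1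
      exact mul_le_mul_of_nonneg_right (mul_le_mul hg.2 this
        (inv_pos.2 (hm.trans_le (hξ j).1)).le hβ) (hw j)
    · rw [hfg, Finset.mul_sum]
      refine Finset.sum_congr rfl fun j _ => ?_
      rw [hlog]
      ring

variable (G)

theorem isConsensusField_entropicProtocol : IsConsensusField G G.entropicProtocol := by
  refine isConsensusField_of_log (fun i => ?_) fun m M hm => ?_
  · unfold entropicProtocol
    refine (ContDiffOn.sum fun j _ => ?_).neg
    refine (contDiffOn_const.mul (contDiff_apply ℝ ℝ i).contDiffOn).mul ?_
    refine ((contDiffOn_log_apply i).sub (contDiffOn_log_apply j)).congr fun x hx => ?_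
    exact Real.log_div (hx i).ne' (hx j).ne'
  · refine ⟨m, max m M, hm, hm.le.trans (le_max_left _ _), fun x hx i =>
      ⟨x i, ⟨(hx i).1, (hx i).2.trans (le_max_right _ _)⟩, ?_⟩⟩
    have hpos : ∀ j, x j ≠ 0 := fun j => (hm.trans_le (hx j).1).ne'
    unfold entropicProtocol
    rw [sum_inNbrs G fun j hj => by simp [hj], Finset.mul_sum, ← Finset.sum_neg_distrib]
    refine Finset.sum_congr rfl fun j _ => ?_
    rw [Real.log_div (hpos i) (hpos j)]
    ring

theorem isConsensusField_scalingInvariantProtocol :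
    IsConsensusField G G.scalingInvariantProtocol := by
  refine isConsensusField_of_log (fun i => ?_) fun m M hm => ?_
  · exact ContDiffOn.sum fun j _ =>
      contDiffOn_const.mul ((contDiffOn_log_apply j).sub (contDiffOn_log_apply i))
  · refine ⟨1, 1, one_pos, zero_le_one, fun x hx i => ⟨1, ⟨le_rfl, le_rfl⟩, ?_⟩⟩
    rw [one_mul]
    exact sum_inNbrs G fun j hj => by simp [hj]

variable {G}

theorem Balanced.polynomialProtocol_eq (hG : G.Balanced) {x : V → ℝ} (hx : ∀ j, 0 < x j) (i : V) :
    G.polynomialProtocol x i = Real.exp (∑ j, G.w i j * Real.log (x j)) -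
      Real.exp (∑ j, G.w i j * Real.log (x i)) := by
  have hin : ∏ j ∈ G.inNbrs i, x j ^ G.w i j = Real.exp (∑ j, G.w i j * Real.log (x j)) := by
    rw [← sum_inNbrs G (i := i) fun j hj => by simp [hj], Real.exp_sum]
    exact Finset.prod_congr rfl fun j _ => by rw [Real.rpow_def_of_pos (hx j), mul_comm]
  have hout : ∏ j ∈ G.outNbrs i, x i ^ G.w j i = Real.exp (∑ j, G.w i j * Real.log (x i)) := by
    -- Balance enters here: the exponent of `x i` is the total outgoing weight, which is replaced by
    -- the total incoming weight.
    rw [← Finset.sum_mul, hG i, Finset.sum_mul, ← sum_outNbrs G (i := i) fun j hj => by simp [hj],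
      Real.exp_sum]
    exact Finset.prod_congr rfl fun j _ => by rw [Real.rpow_def_of_pos (hx i), mul_comm]
  rw [polynomialProtocol, hin, hout]
  ring

theorem Balanced.isConsensusField_polynomialProtocol (hG : G.Balanced) :
    IsConsensusField G G.polynomialProtocol := by
  refine isConsensusField_of_log (fun i => ?_) fun m M hm => ?_
  · have hsmooth : ContDiffOn ℝ 1 (fun x : V → ℝ => Real.exp (∑ j, G.w i j * Real.log (x j)) -
        Real.exp (∑ j, G.w i j * Real.log (x i))) {x | ∀ i, 0 < x i} :=
      (ContDiffOn.sum fun j _ => contDiffOn_const.mul (contDiffOn_log_apply j)).exp.sub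
        (ContDiffOn.sum fun j _ => contDiffOn_const.mul (contDiffOn_log_apply i)).exp
    exact hsmooth.congr fun x hx => hG.polynomialProtocol_eq hx i
  · set L := max |Real.log m| |Real.log M|
    -- `B` bounds both exponents in absolute value on the box, so the factor `Real.exp ξ` from the
    -- mean value theorem lies in `[exp (-B), exp B]`.
    set B := (∑ i, ∑ j, G.w i j) * L
    have hL : 0 ≤ L := (abs_nonneg _).trans (le_max_left _ _)
    refine ⟨Real.exp (-B), Real.exp B, Real.exp_pos _, (Real.exp_pos _).le, fun x hx i => ?_⟩
    have hpos : ∀ j, 0 < x j := fun j => hm.trans_le (hx j).1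
    have hlog : ∀ j, |Real.log (x j)| ≤ L := fun j =>
      abs_le_max_abs_abs (Real.log_le_log hm (hx j).1) (Real.log_le_log (hpos j) (hx j).2)
    have hbound : ∀ y : V → ℝ, (∀ j, |y j| ≤ L) → ∑ j, G.w i j * y j ∈ Icc (-B) B := by
      intro y hy
      rw [Set.mem_Icc, ← abs_le]
      calc |∑ j, G.w i j * y j| ≤ ∑ j, |G.w i j * y j| := Finset.abs_sum_le_sum_abs _ _
        _ ≤ ∑ j, G.w i j * L := Finset.sum_le_sum fun j _ => by
          rw [abs_mul, abs_of_nonneg (G.nonneg i j)]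
          exact mul_le_mul_of_nonneg_left (hy j) (G.nonneg i j)
        _ = (∑ j, G.w i j) * L := (Finset.sum_mul ..).symm
        _ ≤ B := mul_le_mul_of_nonneg_right (Finset.single_le_sum (f := fun i => ∑ j, G.w i j)
          (fun k _ => Finset.sum_nonneg fun l _ => G.nonneg k l) (Finset.mem_univ i)) hL
    obtain ⟨ξ, hξ, he⟩ := exists_sub_eq_mul_sub_of_hasDerivAt
      (fun y _ => Real.hasDerivAt_exp y) (hbound (fun _ => Real.log (x i)) fun _ => hlog i)
      (hbound (fun j => Real.log (x j)) hlog)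
    refine ⟨Real.exp ξ, ⟨Real.exp_le_exp.2 hξ.1, Real.exp_le_exp.2 hξ.2⟩, ?_⟩
    rw [hG.polynomialProtocol_eq hpos, he, ← Finset.sum_sub_distrib]
    simp only [mul_sub]

end WeightedDigraph

theorem theorem1 {V : Type*} [Fintype V] [Nonempty V] (G : WeightedDigraph V)
    (hG : G.StronglyConnected) :
    ConvergesToConsensus G.entropicProtocol ∧
    ConvergesToConsensus G.scalingInvariantProtocol ∧
    (G.Balanced → ConvergesToConsensus G.polynomialProtocol) :=
  ⟨G.isConsensusField_entropicProtocol.convergesToConsensus hG,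
    G.isConsensusField_scalingInvariantProtocol.convergesToConsensus hG,
    fun hb => hb.isConsensusField_polynomialProtocol.convergesToConsensus hG⟩
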